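/- Let $m,n\ge 1$, let $\Sigma$ be a real symmetric positive definite $m\times m$ matrix, $S$ a real $m\times n$ matrix, $\eta\in\mathbb R^m$, $\mu\in\mathbb R^n$ and $t,r\ge 0$. For $u\ge 0$ let $s\mapsto q_m(s,u)$ be the cumulative distribution function of the noncentral $\chi^2$-distribution with $m$ degrees of freedom and noncentrality parameter $u$, that is, of the law of $Z_1^2+\dots+Z_m^2$ with independent normal variables $Z_i$ of variance $1$ whose means $a_i$ satisfy $\sum_i a_i^2=u$. Let $\lambda_{\min}(X)$ be the smallest eigenvalue of a symmetric matrix $X$. (a) Let $\hat t(x)=\|\Sigma^{-1/2}(S\mu+\eta-x)\|_2$ for $x\in\mathbb R^m$, and let $$p(t,r)=\sup_{\lambda\in\mathbb R^n}\bigl\{\,\mathbb P[\hat t(x)\le t : x\sim N(S\lambda+\eta,\Sigma)]\ \bigm|\ \|\mu-\lambda\|_2\ge r\,\bigr\}.$$ Then $$p(t,r)=q_m\bigl(t^2,\ r^2\,\lambda_{\min}(S^T\Sigma^{-1}S)\bigr),$$ and the supremum is attained. (b) Consider the real vector space of Hermitian operators on $\mathbb C^{d_1}\otimes\mathbb C^{d_2}$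 with the Hilbert--Schmidt norm $\|X\|_2=\sqrt{\operatorname{tr}X^\dagger X}$, a real-affine map $T$ from it to $\mathbb R^m$, a density matrix $\rho_0$ and $r_0\ge 0$. Let $\mathcal B=\{\rho_0+r_0X \mid X \text{ Hermitian},\ \operatorname{tr}X=0,\ \|X\|_2\le 1\}$, $\hat t(x)=\|\Sigma^{-1/2}(T(\rho_0)-x)\|_2$, $$p(t,r_0)=\sup_{\rho}\bigl\{\,\mathbb P[\hat t(x)\le t: x\sim N(T(\rho),\Sigma)]\ \bigm|\ \rho\text{ a density matrix},\ \|\rho_0-\rho\|_2\ge r_0\,\bigr\}$$ (with $\sup\emptyset=0$), and $r_1=\inf\{\hat t(T(\Delta)) \mid \Delta \text{ Hermitian},\ \operatorname{tr}\Delta=1,\ \Delta\notin\mathcal B\}$ (with $\inf\emptyset=0$, which occurs only for $d_1d_2=1$). Then $$p(t,r_0)\le q_m(t^2,r_1^2).$$ Moreover, if $d_1d_2\ge 2$, then $r_1^2=r_0^2\,\lambda_{\min}(S^T\Sigma^{-1}S)$, where $S$ is the matrix of the linear part of $T$ restricted to the traceless Hermitian operators, in any Hilbert--Schmidt orthonormal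 basis of these. -/

import Mathlib

open MeasureTheory ProbabilityTheory
open scoped Matrix MatrixOrder ComplexOrder

noncomputable section

namespace GaussTest

/-- The noncentral `χ²`-distribution with `m` degrees of freedom and noncentrality parameter
`u ≥ 0`: the law of `Z₁² + ⋯ + Z_m²` for independent normal variables `Zᵢ` of variance `1`
whose means have squares adding up to `u`. By rotation invariance only `u` matters; the mean
vector used is `(√u, 0, …, 0)`. -/
def noncentralChiSq (m : ℕ) (u : ℝ) : Measure ℝ :=
  (Measure.pi fun i : Fin m => gaussianReal (if (i : ℕ) = 0 then √u else 0) 1).map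
    fun z => ∑ i, z i ^ 2

instance (m : ℕ) (u : ℝ) : IsProbabilityMeasure (noncentralChiSq m u) :=
  Measure.isProbabilityMeasure_map (Measurable.aemeasurable (by fun_prop))

/-- `q m s u`, as a function of `s`, is the cumulative distribution function of the noncentral
`χ²`-distribution with `m` degrees of freedom and noncentrality parameter `u`. -/
def q (m : ℕ) (s u : ℝ) : ℝ := cdf (noncentralChiSq m u) s

/-- The smallest eigenvalue of a real (symmetric) matrix. -/
def lambdaMin {n : ℕ} (A : Matrix (Fin n) (Fin n) ℝ) : ℝ := sInf (spectrum ℝ A)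

/-- The linear image `A v` of a Euclidean vector `v`. -/
def mulVecE {m n : ℕ} (A : Matrix (Fin m) (Fin n) ℝ) (v : EuclideanSpace ℝ (Fin n)) :
    EuclideanSpace ℝ (Fin m) := WithLp.toLp 2 (A *ᵥ v.ofLp)

/-- The test statistic `x ↦ ‖Σ^{-1/2} (c - x)‖₂` with reference point `c`. -/
def testStat {m : ℕ} (Sig : Matrix (Fin m) (Fin m) ℝ) (c x : EuclideanSpace ℝ (Fin m)) : ℝ :=
  ‖mulVecE (CFC.sqrt Sig)⁻¹ (c - x)‖

/-- The probability `ℙ[t̂ ≤ t]` that the test with reference point `c` accepts a sample drawn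
from the normal distribution `N(ξ, Σ)`. -/
def acceptProb {m : ℕ} (Sig : Matrix (Fin m) (Fin m) ℝ) (c ξ : EuclideanSpace ℝ (Fin m))
    (t : ℝ) : ℝ :=
  (multivariateGaussian ξ Sig).real {x | testStat Sig c x ≤ t}

/-- The acceptance probabilities of the test with reference point `S μ + η`, for data from
`N(S lam + η, Σ)`, where `lam` ranges over the null hypothesis `‖μ - lam‖₂ ≥ r`. -/
def nullProbs {m n : ℕ} (Sig : Matrix (Fin m) (Fin m) ℝ) (S : Matrix (Fin m) (Fin n) ℝ)
    (η : EuclideanSpace ℝ (Fin m)) (μ : EuclideanSpace ℝ (Fin n)) (t r : ℝ) : Set ℝ :=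
  {a | ∃ lam : EuclideanSpace ℝ (Fin n), r ≤ ‖μ - lam‖ ∧
    a = acceptProb Sig (mulVecE S μ + η) (mulVecE S lam + η) t}

/-- The worst-case acceptance probability `p(t, r)` under the null hypothesis. -/
def p {m n : ℕ} (Sig : Matrix (Fin m) (Fin m) ℝ) (S : Matrix (Fin m) (Fin n) ℝ)
    (η : EuclideanSpace ℝ (Fin m)) (μ : EuclideanSpace ℝ (Fin n)) (t r : ℝ) : ℝ :=
  sSup (nullProbs Sig S η μ t r)

/-! ### Quantum states -/

/-- The Hermitian operators on `ℂ^κ`; for a bipartite system, `κ = κ₁ × κ₂`. -/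
abbrev Herm (κ : Type*) [Fintype κ] [DecidableEq κ] : Type _ := selfAdjoint (Matrix κ κ ℂ)

variable {κ : Type*} [Fintype κ] [DecidableEq κ]

/-- Density matrices. -/
def IsState (ρ : Herm κ) : Prop := ρ.1.PosSemidef ∧ ρ.1.trace = 1

/-- The (real) Hilbert-Schmidt inner product `tr (X Y)` of Hermitian operators. -/
def hsInner (X Y : Herm κ) : ℝ := (X.1ᴴ * Y.1).trace.re

/-- The Hilbert-Schmidt norm `‖X‖₂ = √(tr X†X)`. -/
def hsNorm (X : Herm κ) : ℝ := √(hsInner X X)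

/-- The Hilbert-Schmidt ball `{ρ + r X | X Hermitian, tr X = 0, ‖X‖₂ ≤ 1}`. -/
def hsBall (ρ : Herm κ) (r : ℝ) : Set (Herm κ) :=
  {Y | ∃ X : Herm κ, X.1.trace = 0 ∧ hsNorm X ≤ 1 ∧ Y = ρ + r • X}

/-- The worst-case probability that the test with target `ρ₀` accepts data from `N(T ρ, Σ)`,
over all states `ρ` with `‖ρ₀ - ρ‖₂ ≥ r₀`. It is `0` if there is no such state. -/
def stateP {m : ℕ} (Sig : Matrix (Fin m) (Fin m) ℝ) (T : Herm κ →ᵃ[ℝ] EuclideanSpace ℝ (Fin m))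
    (ρ₀ : Herm κ) (t r₀ : ℝ) : ℝ :=
  sSup {a | ∃ ρ : Herm κ, IsState ρ ∧ r₀ ≤ hsNorm (ρ₀ - ρ) ∧
    a = acceptProb Sig (T ρ₀) (T ρ) t}

/-- The distance in data space: the infimum of `t̂(T Δ)` over all Hermitian `Δ` of unit trace
outside the ball of radius `r₀` around `ρ₀`. -/
def dataRadius {m : ℕ} (Sig : Matrix (Fin m) (Fin m) ℝ)
    (T : Herm κ →ᵃ[ℝ] EuclideanSpace ℝ (Fin m)) (ρ₀ : Herm κ) (r₀ : ℝ) : ℝ :=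
  sInf {a | ∃ Δ : Herm κ, Δ.1.trace = 1 ∧ Δ ∉ hsBall ρ₀ r₀ ∧ a = testStat Sig (T ρ₀) (T Δ)}

/-- `g` is an orthonormal basis of the real space of traceless Hermitian operators, with the
Hilbert-Schmidt inner product. -/
structure IsTracelessONB {n : ℕ} (g : Fin n → Herm κ) : Prop where
  traceless : ∀ j, (g j).1.trace = 0
  orthonormal : ∀ j k, hsInner (g j) (g k) = if j = k then 1 else 0
  spanning : ∀ X : Herm κ, X.1.trace = 0 → ∃ c : Fin n → ℝ, X = ∑ j, c j • g j

/-- The matrix, in the basis `g`, of the linear part of the measurement map `T` restricted to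
traceless operators. -/
def restrictedMatrix {m n : ℕ} (T : Herm κ →ᵃ[ℝ] EuclideanSpace ℝ (Fin m))
    (g : Fin n → Herm κ) : Matrix (Fin m) (Fin n) ℝ :=
  Matrix.of fun i j => T.linear (g j) i

end GaussTest

end

/-! Whitening by `Σ^{-1/2}` turns the data into a standard Gaussian and the acceptance region into a
ball of radius `t`. By rotation invariance the acceptance probability is therefore `q_m(t², u)`,
with `u` the squared whitened distance between the reference point and the mean (`acceptProb_eq`).
Since `q_m` decreases in `u` (`q_anti`), the worst case minimises `u`.

In (a), `u` is the quadratic form of `SᵀΣ⁻¹S` at `μ - λ`; under `‖μ - λ‖ ≥ r` its minimum is `r²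
λ_min`, reached along an eigenvector.

In (b), `ρ₀ - ρ` is traceless of norm at least `r₀`, and forgetting positivity of `ρ` leaves the
bound by `r₁`. That infimum runs over the open exterior of the ball, whereas states may lie on its
boundary; scaling closes the gap (`dataRadius_le_of_le`). In an orthonormal basis the minimisation
is again that of (a). -/

noncomputable section

namespace GaussTest

/-! ### Gaussian measure of intervals -/

section OneDim

lemma continuous_gaussianPDFReal (μ : ℝ) (v : NNReal) : Continuous (gaussianPDFReal μ v) := by
  unfold gaussianPDFReal
  fun_prop

lemma gaussianPDFReal_zero_one_le {x y : ℝ} (h : y ^ 2 ≤ x ^ 2) :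
    gaussianPDFReal 0 1 x ≤ gaussianPDFReal 0 1 y := by
  simp only [gaussianPDFReal, sub_zero]
  gcongr

/-- The standard Gaussian mass of an interval of fixed length decreases as its centre moves away
from the origin. -/
lemma antitoneOn_integral_gaussianPDFReal {s : ℝ} (hs : 0 ≤ s) :
    AntitoneOn (fun a : ℝ => ∫ x in (-s - a)..(s - a), gaussianPDFReal 0 1 x) (Set.Ici 0) := by
  have hc := continuous_gaussianPDFReal 0 1
  have hd : ∀ a : ℝ, HasDerivAt (fun a : ℝ => ∫ x in (-s - a)..(s - a), gaussianPDFReal 0 1 x)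
      (-gaussianPDFReal 0 1 (s - a) + gaussianPDFReal 0 1 (-s - a)) a := by
    intro a
    have hG : ∀ y : ℝ, HasDerivAt (fun y => ∫ x in (0 : ℝ)..y, gaussianPDFReal 0 1 x)
        (gaussianPDFReal 0 1 y) y := fun y =>
      intervalIntegral.integral_hasDerivAt_right (hc.intervalIntegrable _ _)
        (hc.stronglyMeasurableAtFilter _ _) hc.continuousAt
    have h1 := (hG (s - a)).comp a ((hasDerivAt_id a).const_sub s)
    have h2 := (hG (-s - a)).comp a ((hasDerivAt_id a).const_sub (-s))
    refine ((h1.sub h2).congr_deriv (by ring)).congr_of_eventuallyEq (.of_forall fun b => ?_)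
    simpa using (intervalIntegral.integral_interval_sub_left (hc.intervalIntegrable _ _)
      (hc.intervalIntegrable _ _)).symm
  refine antitoneOn_of_deriv_nonpos (convex_Ici 0)
    (fun a _ => (hd a).continuousAt.continuousWithinAt)
    (fun a _ => (hd a).differentiableAt.differentiableWithinAt) fun a ha => ?_
  rw [interior_Ici, Set.mem_Ioi] at ha
  rw [(hd a).deriv]
  -- For `s, a ≥ 0` the left endpoint `-s - a` is at least as far from `0` as `s - a`, so the
  -- density there is no larger.
  have := gaussianPDFReal_zero_one_le (x := -s - a) (y := s - a) (by nlinarith)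
  linarith

lemma gaussianReal_sq_le_anti {a b : ℝ} (ha : 0 ≤ a) (hab : a ≤ b) (c : ℝ) :
    gaussianReal b 1 {x | x ^ 2 ≤ c} ≤ gaussianReal a 1 {x | x ^ 2 ≤ c} := by
  -- Negative `c` does occur: in `q_anti` it is what the other coordinates leave of `s`.
  rcases lt_or_ge c 0 with hc | hc
  · have : {x : ℝ | x ^ 2 ≤ c} = ∅ := by
      ext x
      simpa using hc.trans_le (sq_nonneg x)
    simp [this]
  have hset : {x : ℝ | x ^ 2 ≤ c} = Set.Icc (-√c) (√c) := by
    ext x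
    rw [Set.mem_ofPred_eq, Set.mem_Icc, Real.sq_le hc]
  have key : ∀ d : ℝ, gaussianReal d 1 {x | x ^ 2 ≤ c}
      = ENNReal.ofReal (∫ x in (-√c - d)..(√c - d), gaussianPDFReal 0 1 x) := by
    intro d
    have hle : -√c - d ≤ √c - d := by linarith [Real.sqrt_nonneg c]
    rw [hset, ← zero_add d, ← gaussianReal_map_add_const d,
      Measure.map_apply (by fun_prop) measurableSet_Icc, Set.preimage_add_const_Icc, zero_add,
      gaussianReal_apply_eq_integral _ one_ne_zero, integral_Icc_eq_integral_Ioc,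
      intervalIntegral.integral_of_le hle]
  rw [key, key]
  exact ENNReal.ofReal_le_ofReal
    (antitoneOn_integral_gaussianPDFReal (Real.sqrt_nonneg c) ha (ha.trans hab) hab)

end OneDim

/-! ### The noncentral chi-squared distribution function -/

section ChiSq

lemma q_eq (m : ℕ) (s u : ℝ) :
    q m s u = (Measure.pi fun i : Fin m => gaussianReal (if (i : ℕ) = 0 then √u else 0) 1).real
      {z | ∑ i, z i ^ 2 ≤ s} := by
  rw [q, cdf_eq_real, noncentralChiSq, map_measureReal_apply (by fun_prop) measurableSet_Iic]
  rfl

/-- The noncentral `χ²` cumulative distribution function decreases in the noncentrality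
parameter. -/
lemma q_anti {m : ℕ} (hm : 1 ≤ m) (s : ℝ) {u v : ℝ} (huv : u ≤ v) : q m s v ≤ q m s u := by
  obtain ⟨k, rfl⟩ := Nat.exists_eq_add_of_le' hm
  -- Fubini isolates coordinate `0`, the only one whose mean depends on `w`; each slice is then a
  -- one-dimensional comparison.
  have key : ∀ w : ℝ,
      (Measure.pi fun i : Fin (k + 1) => gaussianReal (if (i : ℕ) = 0 then √w else 0) 1)
        {z | ∑ i, z i ^ 2 ≤ s}
      = ∫⁻ y, gaussianReal (√w) 1 {x | x ^ 2 ≤ s - ∑ i, y i ^ 2}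
          ∂(Measure.pi fun _ : Fin k => gaussianReal 0 1) := by
    intro w
    have hmp := (measurePreserving_piFinSuccAbove
      (fun i : Fin (k + 1) => gaussianReal (if (i : ℕ) = 0 then √w else 0) 1) 0).symm
    have hS : MeasurableSet {z : Fin (k + 1) → ℝ | ∑ i, z i ^ 2 ≤ s} :=
      measurableSet_le (by fun_prop) (by fun_prop)
    rw [← hmp.measure_preimage hS.nullMeasurableSet, Measure.prod_apply_symm (hmp.measurable hS)]
    simp only [Fin.val_zero, if_true, Fin.succAbove_zero, Fin.val_succ, Nat.succ_ne_zero, if_false]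
    refine lintegral_congr fun y => congrArg _ ?_
    ext x
    simp [Fin.sum_univ_succ, le_sub_iff_add_le, MeasurableEquiv.piFinSuccAbove,
      Fin.insertNthEquiv]
  rw [q_eq, q_eq, measureReal_def, measureReal_def]
  refine ENNReal.toReal_mono (measure_ne_top _ _) ?_
  rw [key, key]
  exact lintegral_mono fun y =>
    gaussianReal_sq_le_anti (Real.sqrt_nonneg _) (Real.sqrt_le_sqrt huv) _

lemma q_nonneg (m : ℕ) (s u : ℝ) : 0 ≤ q m s u := cdf_nonneg _ _

/-- The standard Gaussian measure of a closed ball depends only on the norm of its centre. -/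
lemma stdGaussian_closedBall_congr {E : Type*} [NormedAddCommGroup E] [InnerProductSpace ℝ E]
    [FiniteDimensional ℝ E] [MeasurableSpace E] [BorelSpace E] {a b : E} (h : ‖a‖ = ‖b‖) (t : ℝ) :
    stdGaussian E (Metric.closedBall a t) = stdGaussian E (Metric.closedBall b t) := by
  let f := (Submodule.span ℝ {a - b})ᗮ.reflection
  have hf : f a = b := Submodule.reflection_sub h
  have hball : f ⁻¹' Metric.closedBall b t = Metric.closedBall a t := by
    rw [f.preimage_closedBall, ← hf, f.symm_apply_apply]
  rw [← hball, ← Measure.map_apply f.continuous.measurable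
    Metric.isClosed_closedBall.measurableSet, stdGaussian_map]

lemma stdGaussian_closedBall_eq_q {m : ℕ} (hm : 1 ≤ m) (a : EuclideanSpace ℝ (Fin m)) {t : ℝ}
    (ht : 0 ≤ t) :
    (stdGaussian (EuclideanSpace ℝ (Fin m))).real (Metric.closedBall a t)
      = q m (t ^ 2) (‖a‖ ^ 2) := by
  obtain ⟨k, rfl⟩ := Nat.exists_eq_add_of_le' hm
  -- The minus sign makes `z - e` the shift of `z` by `+‖a‖` in coordinate `0`, matching the mean
  -- vector in `noncentralChiSq`.
  let e : EuclideanSpace ℝ (Fin (k + 1)) := EuclideanSpace.single 0 (-‖a‖)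
  have he : ‖a‖ = ‖e‖ := by simp [e]
  have hpi : (Measure.pi fun i : Fin (k + 1) => gaussianReal (if (i : ℕ) = 0 then ‖a‖ else 0) 1)
      = (Measure.pi fun _ : Fin (k + 1) => gaussianReal 0 1).map
        (fun z (i : Fin (k + 1)) => z i + if (i : ℕ) = 0 then ‖a‖ else 0) := by
    rw [Measure.pi_map_pi (f := fun (i : Fin (k + 1)) x => x + if (i : ℕ) = 0 then ‖a‖ else 0)
      (fun i => by fun_prop)]
    simp [gaussianReal_map_add_const]
  have hS : MeasurableSet {z : Fin (k + 1) → ℝ | ∑ i, z i ^ 2 ≤ t ^ 2} :=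
    measurableSet_le (by fun_prop) (by fun_prop)
  rw [measureReal_def, stdGaussian_closedBall_congr he, ← measureReal_def, q_eq,
    Real.sqrt_sq (norm_nonneg _), hpi, map_measureReal_apply (by fun_prop) hS,
    ← map_pi_eq_stdGaussian, map_measureReal_apply (by fun_prop)
      Metric.isClosed_closedBall.measurableSet]
  congr 1
  ext z
  rw [Set.mem_preimage, Set.mem_preimage, mem_closedBall_iff_norm, Set.mem_ofPred_eq,
    ← sq_le_sq₀ (norm_nonneg _) ht, EuclideanSpace.real_norm_sq_eq]
  simp [e, Fin.sum_univ_succ]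

end ChiSq

/-! ### Whitening the test statistic -/

section Accept

variable {m n : ℕ}

lemma mulVecE_sub (A : Matrix (Fin m) (Fin n) ℝ) (v w : EuclideanSpace ℝ (Fin n)) :
    mulVecE A (v - w) = mulVecE A v - mulVecE A w := by
  simp [mulVecE, Matrix.mulVec_sub]

lemma mulVecE_smul (A : Matrix (Fin m) (Fin n) ℝ) (c : ℝ) (v : EuclideanSpace ℝ (Fin n)) :
    mulVecE A (c • v) = c • mulVecE A v := by
  simp [mulVecE, Matrix.mulVec_smul]

lemma mulVecE_mulVecE {k : ℕ} (A : Matrix (Fin m) (Fin n) ℝ) (B : Matrix (Fin n) (Fin k) ℝ)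
    (v : EuclideanSpace ℝ (Fin k)) : mulVecE A (mulVecE B v) = mulVecE (A * B) v := by
  simp [mulVecE, Matrix.mulVec_mulVec]

lemma mulVecE_one (v : EuclideanSpace ℝ (Fin n)) : mulVecE 1 v = v := by
  simp [mulVecE]

lemma continuous_mulVecE (A : Matrix (Fin m) (Fin n) ℝ) : Continuous (mulVecE A) := by
  unfold mulVecE
  fun_prop

lemma isUnit_det_sqrt {Sig : Matrix (Fin m) (Fin m) ℝ} (hSig : Sig.PosDef) :
    IsUnit (CFC.sqrt Sig).det := by
  have h : (CFC.sqrt Sig).det * (CFC.sqrt Sig).det = Sig.det := by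
    rw [← Matrix.det_mul, CFC.sqrt_mul_sqrt_self _ hSig.posSemidef.nonneg]
  exact isUnit_of_mul_isUnit_left (h ▸ hSig.det_pos.ne'.isUnit)

/-- The acceptance probability is a noncentral `χ²` cumulative probability. -/
lemma acceptProb_eq (hm : 1 ≤ m) {Sig : Matrix (Fin m) (Fin m) ℝ} (hSig : Sig.PosDef)
    (c ξ : EuclideanSpace ℝ (Fin m)) {t : ℝ} (ht : 0 ≤ t) :
    acceptProb Sig c ξ t = q m (t ^ 2) (testStat Sig c ξ ^ 2) := by
  have hS : MeasurableSet {x | testStat Sig c x ≤ t} := by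
    refine (isClosed_le ?_ continuous_const).measurableSet
    exact ((continuous_mulVecE _).comp (continuous_const.sub continuous_id)).norm
  rw [acceptProb, multivariateGaussian, map_measureReal_apply (by fun_prop) hS, testStat,
    ← stdGaussian_closedBall_eq_q hm _ ht]
  congr 1
  ext z
  have hz : Matrix.toEuclideanCLM (𝕜 := ℝ) (CFC.sqrt Sig) z = mulVecE (CFC.sqrt Sig) z := rfl
  -- For `x = ξ + Σ^{1/2} z` the whitened residual is `Σ^{-1/2}(c - ξ) - z`, so acceptance means
  -- that `z` lies in a ball.
  rw [Set.mem_preimage, Set.mem_ofPred_eq, testStat, hz, ← sub_sub, mulVecE_sub, mulVecE_mulVecE,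
    Matrix.nonsing_inv_mul _ (isUnit_det_sqrt hSig), mulVecE_one, mem_closedBall_iff_norm']

end Accept

/-! ### Rayleigh bound and part (a) -/

section LambdaMin

variable {m n : ℕ}

/-- Subtracting `λ_min` times the identity shifts the spectrum into `[0, ∞)`, leaving a positive
semidefinite matrix. -/
lemma lambdaMin_mul_le {A : Matrix (Fin n) (Fin n) ℝ} (hA : A.IsHermitian)
    (v : EuclideanSpace ℝ (Fin n)) : lambdaMin A * ‖v‖ ^ 2 ≤ v.ofLp ⬝ᵥ A *ᵥ v.ofLp := by
  have hpsd : (A - algebraMap ℝ _ (lambdaMin A)).PosSemidef := by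
    refine Matrix.posSemidef_iff_isHermitian_and_spectrum_nonneg.2 ⟨?_, ?_⟩
    · refine hA.sub ?_
      simp [Matrix.IsHermitian, Matrix.algebraMap_eq_diagonal]
    · intro x hx
      rw [sub_eq_add_neg, ← map_neg, ← spectrum.add_singleton_eq] at hx
      obtain ⟨y, hy, z, rfl, rfl⟩ := hx
      have := csInf_le A.finite_real_spectrum.bddBelow hy
      simp only [Set.mem_ofPred_eq, lambdaMin] at *
      linarith
  have h := hpsd.dotProduct_mulVec_nonneg v.ofLp
  rw [Matrix.sub_mulVec, dotProduct_sub, Algebra.algebraMap_eq_smul_one, Matrix.smul_mulVec,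
    Matrix.one_mulVec, dotProduct_smul, star_trivial] at h
  rw [EuclideanSpace.real_norm_sq_eq]
  have h2 : v.ofLp ⬝ᵥ v.ofLp = ∑ i, v i ^ 2 := by simp [dotProduct, sq]
  rw [h2, smul_eq_mul] at h
  linarith

/-- For `n ≥ 1` the spectrum is finite and nonempty, so its infimum is an eigenvalue. -/
lemma exists_unit_eq_lambdaMin (hn : 1 ≤ n) {A : Matrix (Fin n) (Fin n) ℝ} (hA : A.IsHermitian) :
    ∃ v : EuclideanSpace ℝ (Fin n), ‖v‖ = 1 ∧ v.ofLp ⬝ᵥ A *ᵥ v.ofLp = lambdaMin A := by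
  have hmem : lambdaMin A ∈ spectrum ℝ A :=
    Set.Nonempty.csInf_mem ⟨_, hA.eigenvalues_mem_spectrum_real ⟨0, hn⟩⟩ A.finite_real_spectrum
  rw [hA.spectrum_real_eq_range_eigenvalues] at hmem
  obtain ⟨i, hi⟩ := hmem
  have h1 : ‖hA.eigenvectorBasis i‖ = 1 := hA.eigenvectorBasis.orthonormal.1 i
  refine ⟨hA.eigenvectorBasis i, h1, ?_⟩
  have h2 := EuclideanSpace.real_norm_sq_eq (hA.eigenvectorBasis i)
  rw [h1] at h2
  rw [hA.mulVec_eigenvectorBasis, dotProduct_smul, hi, dotProduct]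
  simp only [← sq]
  rw [← h2]
  simp

variable {Sig : Matrix (Fin m) (Fin m) ℝ} (S : Matrix (Fin m) (Fin n) ℝ)

lemma norm_sq_mulVecE_whitened (hSig : Sig.PosDef) (v : EuclideanSpace ℝ (Fin n)) :
    ‖mulVecE (CFC.sqrt Sig)⁻¹ (mulVecE S v)‖ ^ 2 = v.ofLp ⬝ᵥ (Sᵀ * Sig⁻¹ * S) *ᵥ v.ofLp := by
  have hsymm : (CFC.sqrt Sig)ᵀ = CFC.sqrt Sig := by
    have := (CFC.sqrt_nonneg Sig).isSelfAdjoint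
    rwa [isSelfAdjoint_iff, Matrix.star_eq_conjTranspose,
      Matrix.conjTranspose_eq_transpose_of_trivial] at this
  have hinv : ((CFC.sqrt Sig)⁻¹)ᵀ * (CFC.sqrt Sig)⁻¹ = Sig⁻¹ := by
    rw [Matrix.transpose_nonsing_inv, hsymm, ← Matrix.mul_inv_rev,
      CFC.sqrt_mul_sqrt_self _ hSig.posSemidef.nonneg]
  rw [mulVecE_mulVecE, EuclideanSpace.real_norm_sq_eq, ← hinv, ← Matrix.mul_assoc,
    ← Matrix.transpose_mul, Matrix.mul_assoc, ← Matrix.mulVec_mulVec, Matrix.dotProduct_mulVec,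
    Matrix.vecMul_transpose]
  simp [mulVecE, dotProduct, sq]

lemma isHermitian_whitened (hSig : Sig.PosDef) : (Sᵀ * Sig⁻¹ * S).IsHermitian := by
  have := hSig.inv.posSemidef.conjTranspose_mul_mul_same S
  rw [Matrix.conjTranspose_eq_transpose_of_trivial] at this
  exact this.isHermitian

lemma lambdaMin_whitened_nonneg (hSig : Sig.PosDef) (hn : 1 ≤ n) :
    0 ≤ lambdaMin (Sᵀ * Sig⁻¹ * S) := by
  obtain ⟨v, -, hv⟩ := exists_unit_eq_lambdaMin hn (isHermitian_whitened S hSig)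
  rw [← hv, ← norm_sq_mulVecE_whitened S hSig]
  positivity

/-- The worst-case acceptance probability, attained at `lam = μ - r v` for an eigenvector `v`
to the smallest eigenvalue. -/
lemma isGreatest_nullProbs (hm : 1 ≤ m) (hn : 1 ≤ n) (hSig : Sig.PosDef)
    (η : EuclideanSpace ℝ (Fin m)) (μ : EuclideanSpace ℝ (Fin n)) {t r : ℝ} (ht : 0 ≤ t)
    (hr : 0 ≤ r) :
    IsGreatest (nullProbs Sig S η μ t r) (q m (t ^ 2) (r ^ 2 * lambdaMin (Sᵀ * Sig⁻¹ * S))) := by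
  have hA := isHermitian_whitened S hSig
  have key : ∀ lam : EuclideanSpace ℝ (Fin n),
      acceptProb Sig (mulVecE S μ + η) (mulVecE S lam + η) t
        = q m (t ^ 2) ((μ - lam).ofLp ⬝ᵥ (Sᵀ * Sig⁻¹ * S) *ᵥ (μ - lam).ofLp) := by
    intro lam
    rw [acceptProb_eq hm hSig _ _ ht, testStat, add_sub_add_right_eq_sub, ← mulVecE_sub,
      norm_sq_mulVecE_whitened S hSig]
  constructor
  · obtain ⟨v, hv1, hv⟩ := exists_unit_eq_lambdaMin hn hA
    refine ⟨μ - r • v, ?_, ?_⟩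
    · simp [norm_smul, hv1, abs_of_nonneg hr]
    · rw [key, sub_sub_cancel, WithLp.ofLp_smul, Matrix.mulVec_smul, dotProduct_smul,
        smul_dotProduct, hv, smul_eq_mul, smul_eq_mul, ← mul_assoc, sq r]
  · rintro _ ⟨lam, hlam, rfl⟩
    rw [key]
    refine q_anti hm _ (le_trans ?_ (lambdaMin_mul_le hA _))
    rw [mul_comm]
    -- Enlarging `r` to `‖μ - lam‖` increases the bound only because `λ_min ≥ 0`.
    exact mul_le_mul_of_nonneg_left (by gcongr) (lambdaMin_whitened_nonneg S hSig hn)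

end LambdaMin

/-! ### Hilbert-Schmidt geometry of Hermitian operators -/

section HilbertSchmidt

variable {κ : Type*} [Fintype κ] [DecidableEq κ]

lemma hsInner_add_left (X Y Z : Herm κ) : hsInner (X + Y) Z = hsInner X Z + hsInner Y Z := by
  simp [hsInner, Matrix.add_mul]

lemma hsInner_smul_left (c : ℝ) (X Y : Herm κ) : hsInner (c • X) Y = c * hsInner X Y := by
  simp [hsInner, Matrix.conjTranspose_smul]

lemma hsInner_add_right (X Y Z : Herm κ) : hsInner X (Y + Z) = hsInner X Y + hsInner X Z := by
  simp [hsInner, Matrix.mul_add]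

lemma hsInner_smul_right (c : ℝ) (X Y : Herm κ) : hsInner X (c • Y) = c * hsInner X Y := by
  simp [hsInner]

variable (κ) in
/-- The Hilbert-Schmidt inner product as a bilinear form. -/
def hsForm : Herm κ →ₗ[ℝ] Herm κ →ₗ[ℝ] ℝ :=
  LinearMap.mk₂ ℝ hsInner hsInner_add_left hsInner_smul_left hsInner_add_right hsInner_smul_right

lemma hsForm_apply (X Y : Herm κ) : hsForm κ X Y = hsInner X Y := rfl

lemma hsInner_self (X : Herm κ) : hsInner X X = ∑ j, ∑ i, ‖X.1 i j‖ ^ 2 := by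
  simp [hsInner, Matrix.trace, Matrix.mul_apply, ← Complex.normSq_eq_norm_sq, Complex.normSq_apply]

lemma hsInner_self_nonneg (X : Herm κ) : 0 ≤ hsInner X X := by
  rw [hsInner_self]
  positivity

lemma hsNorm_nonneg (X : Herm κ) : 0 ≤ hsNorm X := Real.sqrt_nonneg _

lemma hsNorm_smul (c : ℝ) (X : Herm κ) : hsNorm (c • X) = |c| * hsNorm X := by
  rw [hsNorm, hsInner_smul_left, hsInner_smul_right, ← mul_assoc, Real.sqrt_mul (mul_self_nonneg c),
    Real.sqrt_mul_self_eq_abs, hsNorm]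

lemma hsNorm_eq_zero {X : Herm κ} : hsNorm X = 0 ↔ X = 0 := by
  constructor
  · intro h
    rw [hsNorm, Real.sqrt_eq_zero (hsInner_self_nonneg X), hsInner_self,
      Finset.sum_eq_zero_iff_of_nonneg (fun _ _ => by positivity)] at h
    ext i j
    have hj := (Finset.sum_eq_zero_iff_of_nonneg (fun _ _ => by positivity)).1
      (h j (Finset.mem_univ j)) i (Finset.mem_univ i)
    simpa using hj
  · rintro rfl
    simp [hsNorm, hsInner]

lemma mem_hsBall_iff {ρ Y : Herm κ} {r : ℝ} (hr : 0 ≤ r) :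
    Y ∈ hsBall ρ r ↔ (ρ - Y).1.trace = 0 ∧ hsNorm (ρ - Y) ≤ r := by
  constructor
  · rintro ⟨X, hX, hX1, rfl⟩
    have h : ρ - (ρ + r • X) = (-r) • X := by module
    rw [h]
    refine ⟨by simp [hX], ?_⟩
    rw [hsNorm_smul, abs_neg, abs_of_nonneg hr]
    exact mul_le_of_le_one_right hr hX1
  · rintro ⟨htr, hle⟩
    -- Radius `0` forbids dividing by `r`; there definiteness of the norm gives `Y = ρ`.
    rcases hr.eq_or_lt with rfl | hr
    · have h0 := hsNorm_eq_zero.1 (hle.antisymm (hsNorm_nonneg _))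
      refine ⟨0, by simp, by simp [hsNorm, hsInner], ?_⟩
      rw [smul_zero, add_zero, sub_eq_zero.1 h0]
    · refine ⟨(-r⁻¹) • (ρ - Y), ?_, ?_, ?_⟩
      · rw [selfAdjoint.val_smul, Matrix.trace_smul, htr, smul_zero]
      · rw [hsNorm_smul, abs_neg, abs_of_pos (inv_pos.2 hr)]
        exact (inv_mul_le_one₀ hr).2 hle
      · rw [smul_smul, mul_neg, mul_inv_cancel₀ hr.ne']
        module

/-- Parseval's identity, which transfers the minimisation over operators to Euclidean coordinates.
-/
lemma hsNorm_sum_smul {n : ℕ} {g : Fin n → Herm κ} (hg : IsTracelessONB g)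
    (c : EuclideanSpace ℝ (Fin n)) : hsNorm (∑ j, c j • g j) = ‖c‖ := by
  rw [hsNorm, EuclideanSpace.norm_eq, ← hsForm_apply]
  congr 1
  simp [map_sum, LinearMap.sum_apply, hsForm_apply, hg.orthonormal, sq]

lemma trace_sum_smul {n : ℕ} {g : Fin n → Herm κ} (hg : IsTracelessONB g) (c : Fin n → ℝ) :
    (∑ j, c j • g j).1.trace = 0 := by
  rw [AddSubgroup.val_finsetSum, Matrix.trace_sum]
  refine Finset.sum_eq_zero fun j _ => ?_
  rw [selfAdjoint.val_smul, Matrix.trace_smul, hg.traceless, smul_zero]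

end HilbertSchmidt

/-! ### Quantum states and part (b) -/

section States

variable {κ : Type*} [Fintype κ] [DecidableEq κ] {m : ℕ} {Sig : Matrix (Fin m) (Fin m) ℝ}
  {T : Herm κ →ᵃ[ℝ] EuclideanSpace ℝ (Fin m)} {ρ₀ : Herm κ} {r₀ : ℝ}

lemma testStat_nonneg (c x : EuclideanSpace ℝ (Fin m)) : 0 ≤ testStat Sig c x := norm_nonneg _

lemma testStat_map_eq (X Y : Herm κ) :
    testStat Sig (T X) (T Y) = ‖mulVecE (CFC.sqrt Sig)⁻¹ (T.linear (X - Y))‖ := by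
  rw [testStat, ← vsub_eq_sub (T X), ← AffineMap.linearMap_vsub, vsub_eq_sub]

lemma dataRadius_nonneg : 0 ≤ dataRadius Sig T ρ₀ r₀ := by
  refine Real.sInf_nonneg ?_
  rintro _ ⟨Δ, -, -, rfl⟩
  exact testStat_nonneg _ _

/-- The data radius in terms of the traceless deviation from the target state. -/
lemma dataRadius_eq (hρ : ρ₀.1.trace = 1) (hr : 0 ≤ r₀) :
    dataRadius Sig T ρ₀ r₀ = sInf {a | ∃ X : Herm κ, X.1.trace = 0 ∧ r₀ < hsNorm X ∧
      a = ‖mulVecE (CFC.sqrt Sig)⁻¹ (T.linear X)‖} := by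
  rw [dataRadius]
  congr 1
  ext a
  constructor
  · rintro ⟨Δ, hΔ, hout, rfl⟩
    have htr : (ρ₀ - Δ).1.trace = 0 := by
      rw [AddSubgroupClass.coe_sub, Matrix.trace_sub, hρ, hΔ, sub_self]
    refine ⟨ρ₀ - Δ, htr, ?_, testStat_map_eq _ _⟩
    by_contra h
    exact hout ((mem_hsBall_iff hr).2 ⟨htr, not_lt.1 h⟩)
  · rintro ⟨X, hX, hlt, rfl⟩
    refine ⟨ρ₀ - X, ?_, ?_, ?_⟩
    · rw [AddSubgroupClass.coe_sub, Matrix.trace_sub, hρ, hX, sub_zero]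
    · rw [mem_hsBall_iff hr, sub_sub_cancel]
      exact fun h => h.2.not_gt hlt
    · rw [testStat_map_eq, sub_sub_cancel]

lemma dataRadius_le_of_lt (hρ : ρ₀.1.trace = 1) (hr : 0 ≤ r₀) {X : Herm κ} (hX : X.1.trace = 0)
    (hlt : r₀ < hsNorm X) :
    dataRadius Sig T ρ₀ r₀ ≤ ‖mulVecE (CFC.sqrt Sig)⁻¹ (T.linear X)‖ := by
  rw [dataRadius_eq hρ hr]
  refine csInf_le ⟨0, ?_⟩ ⟨X, hX, hlt, rfl⟩
  rintro _ ⟨Y, -, -, rfl⟩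
  exact norm_nonneg _

lemma norm_whitened_smul (c : ℝ) (X : Herm κ) :
    ‖mulVecE (CFC.sqrt Sig)⁻¹ (T.linear (c • X))‖
      = |c| * ‖mulVecE (CFC.sqrt Sig)⁻¹ (T.linear X)‖ := by
  rw [map_smul, mulVecE_smul, norm_smul, Real.norm_eq_abs]

/-- By scaling, the bound by the data radius extends to the boundary of the ball. -/
lemma dataRadius_le_of_le (hρ : ρ₀.1.trace = 1) (hr : 0 ≤ r₀) {X : Herm κ} (hX : X.1.trace = 0)
    (hle : r₀ ≤ hsNorm X) :
    dataRadius Sig T ρ₀ r₀ ≤ ‖mulVecE (CFC.sqrt Sig)⁻¹ (T.linear X)‖ := by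
  -- The points `(a + ε) Y` lie strictly outside the ball; let `ε → 0`. It is used with `a = 1` for
  -- `Y = X ≠ 0`, and with `a = 0` in any nonzero direction when `X = 0`.
  have scale : ∀ (Y : Herm κ) (a : ℝ), 0 ≤ a → Y.1.trace = 0 →
      (∀ ε : ℝ, 0 < ε → r₀ < (a + ε) * hsNorm Y) →
      dataRadius Sig T ρ₀ r₀ ≤ a * ‖mulVecE (CFC.sqrt Sig)⁻¹ (T.linear Y)‖ := by
    intro Y a ha hY h
    have hcont : Filter.Tendsto
        (fun ε : ℝ => (a + ε) * ‖mulVecE (CFC.sqrt Sig)⁻¹ (T.linear Y)‖)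
        (nhdsWithin 0 (Set.Ioi 0)) (nhds (a * ‖mulVecE (CFC.sqrt Sig)⁻¹ (T.linear Y)‖)) := by
      refine tendsto_nhdsWithin_of_tendsto_nhds (Continuous.tendsto' (by fun_prop) _ _ (by simp))
    refine ge_of_tendsto hcont (Filter.eventually_of_mem self_mem_nhdsWithin fun ε hε => ?_)
    have hpos : 0 < a + ε := add_pos_of_nonneg_of_pos ha hε
    have := dataRadius_le_of_lt (Sig := Sig) (T := T) hρ hr (X := (a + ε) • Y)
      (by rw [selfAdjoint.val_smul, Matrix.trace_smul, hY, smul_zero])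
      (by rw [hsNorm_smul, abs_of_pos hpos]; exact h ε hε)
    rwa [norm_whitened_smul, abs_of_pos hpos] at this
  by_cases hX0 : X = 0
  · subst hX0
    rw [hsNorm_eq_zero.2 rfl] at hle
    -- With no nonzero traceless operator the infimum is over the empty set, hence `0`.
    by_cases hY : ∃ Y : Herm κ, Y.1.trace = 0 ∧ 0 < hsNorm Y
    · obtain ⟨Y, hYtr, hYpos⟩ := hY
      have := scale Y 0 le_rfl hYtr fun ε hε => by
        rw [zero_add]
        exact hle.trans_lt (mul_pos hε hYpos)
      rw [zero_mul] at this
      exact this.trans (norm_nonneg _)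
    · have hempty : {a | ∃ X : Herm κ, X.1.trace = 0 ∧ r₀ < hsNorm X ∧
          a = ‖mulVecE (CFC.sqrt Sig)⁻¹ (T.linear X)‖} = ∅ :=
        Set.eq_empty_of_forall_notMem fun a ⟨Y, hYtr, hlt, _⟩ => hY ⟨Y, hYtr, hr.trans_lt hlt⟩
      rw [dataRadius_eq hρ hr, hempty, Real.sInf_empty]
      exact norm_nonneg _
  · have hpos : 0 < hsNorm X :=
      (hsNorm_nonneg X).lt_of_ne fun h => hX0 (hsNorm_eq_zero.1 h.symm)
    have := scale X 1 zero_le_one hX fun ε hε => by nlinarith [mul_pos hε hpos]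
    rwa [one_mul] at this

lemma stateP_le (hm : 1 ≤ m) (hSig : Sig.PosDef) (hρ : IsState ρ₀) (hr : 0 ≤ r₀) {t : ℝ}
    (ht : 0 ≤ t) : stateP Sig T ρ₀ t r₀ ≤ q m (t ^ 2) (dataRadius Sig T ρ₀ r₀ ^ 2) := by
  -- Nonnegativity of `q` covers an empty set of states, whose supremum is `0`.
  refine Real.sSup_le ?_ (q_nonneg _ _ _)
  rintro _ ⟨ρ, hρ', hle, rfl⟩
  rw [acceptProb_eq hm hSig _ _ ht]
  refine q_anti hm _ (pow_le_pow_left₀ dataRadius_nonneg ?_ 2)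
  rw [testStat_map_eq]
  refine dataRadius_le_of_le hρ.2 hr ?_ hle
  rw [AddSubgroupClass.coe_sub, Matrix.trace_sub, hρ.2, hρ'.2, sub_self]

lemma linear_sum_smul {n : ℕ} (g : Fin n → Herm κ) (c : EuclideanSpace ℝ (Fin n)) :
    T.linear (∑ j, c j • g j) = mulVecE (restrictedMatrix T g) c := by
  ext i
  simp [mulVecE, restrictedMatrix, Matrix.mulVec, dotProduct, mul_comm]

lemma dataRadius_sq_eq (hSig : Sig.PosDef) (hρ : ρ₀.1.trace = 1) (hr : 0 ≤ r₀) {n : ℕ}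
    (hn : 1 ≤ n) {g : Fin n → Herm κ} (hg : IsTracelessONB g) :
    dataRadius Sig T ρ₀ r₀ ^ 2
      = r₀ ^ 2 * lambdaMin ((restrictedMatrix T g)ᵀ * Sig⁻¹ * restrictedMatrix T g) := by
  set S := restrictedMatrix T g
  have hl := lambdaMin_whitened_nonneg S hSig hn
  have hA := isHermitian_whitened S hSig
  obtain ⟨v, hv1, hv⟩ := exists_unit_eq_lambdaMin hn hA
  rw [← norm_sq_mulVecE_whitened S hSig] at hv
  set l := lambdaMin (Sᵀ * Sig⁻¹ * S)
  suffices h : dataRadius Sig T ρ₀ r₀ = r₀ * √l by rw [h, mul_pow, Real.sq_sqrt hl]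
  apply le_antisymm
  · have htr : ∀ c : EuclideanSpace ℝ (Fin n), r₀ ≤ ‖c‖ →
        dataRadius Sig T ρ₀ r₀ ≤ ‖mulVecE (CFC.sqrt Sig)⁻¹ (mulVecE S c)‖ := by
      intro c hc
      rw [← linear_sum_smul]
      exact dataRadius_le_of_le hρ hr (trace_sum_smul hg _) (by rwa [hsNorm_sum_smul hg])
    -- The minimiser `r₀ v` lies on the boundary, outside the index set of the infimum, hence the
    -- use of `dataRadius_le_of_le`.
    have h := htr (r₀ • v) (by rw [norm_smul, hv1, mul_one]; exact le_abs_self r₀)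
    rwa [mulVecE_smul, mulVecE_smul, norm_smul, Real.norm_eq_abs, abs_of_nonneg hr,
      ← Real.sqrt_sq (norm_nonneg (mulVecE _ _)), hv] at h
  · rw [dataRadius_eq hρ hr]
    -- A point strictly outside the ball shows that the infimum is not the default value of an empty
    -- set.
    have hne : ∃ w : EuclideanSpace ℝ (Fin n), r₀ < ‖w‖ :=
      ⟨(r₀ + 1) • v, by rw [norm_smul, hv1, mul_one]; exact (lt_add_one r₀).trans_le (le_abs_self _)⟩
    obtain ⟨w, hw⟩ := hne
    refine le_csInf ⟨_, ∑ j, w j • g j, trace_sum_smul hg _, by rwa [hsNorm_sum_smul hg], rfl⟩ ?_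
    rintro _ ⟨X, hX, hlt, rfl⟩
    obtain ⟨c, rfl⟩ := hg.spanning X hX
    obtain ⟨c, rfl⟩ := (WithLp.equiv 2 (Fin n → ℝ)).surjective c
    change _ ≤ ‖mulVecE (CFC.sqrt Sig)⁻¹ (T.linear (∑ j, c j • g j))‖
    change r₀ < hsNorm (∑ j, c j • g j) at hlt
    rw [hsNorm_sum_smul hg] at hlt
    rw [linear_sum_smul]
    refine (sq_le_sq₀ (mul_nonneg hr (Real.sqrt_nonneg l)) (norm_nonneg _)).1 ?_
    rw [norm_sq_mulVecE_whitened S hSig, mul_pow, Real.sq_sqrt hl, mul_comm]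
    refine le_trans ?_ (lambdaMin_mul_le hA c)
    exact mul_le_mul_of_nonneg_left (by gcongr) hl

end States

end GaussTest

end

theorem lemma1 {m : ℕ} (hm : 1 ≤ m) (Sig : Matrix (Fin m) (Fin m) ℝ) (hSig : Sig.PosDef)
    (t : ℝ) (ht : 0 ≤ t) :
    (∀ (n : ℕ) (_ : 1 ≤ n) (S : Matrix (Fin m) (Fin n) ℝ) (η : EuclideanSpace ℝ (Fin m))
        (μ : EuclideanSpace ℝ (Fin n)) (r : ℝ) (_ : 0 ≤ r),
      GaussTest.p Sig S η μ t r
          = GaussTest.q m (t ^ 2) (r ^ 2 * GaussTest.lambdaMin (Sᵀ * Sig⁻¹ * S)) ∧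
        GaussTest.p Sig S η μ t r ∈ GaussTest.nullProbs Sig S η μ t r) ∧
    (∀ (d₁ d₂ : ℕ) (T : GaussTest.Herm (Fin d₁ × Fin d₂) →ᵃ[ℝ] EuclideanSpace ℝ (Fin m))
        (ρ₀ : GaussTest.Herm (Fin d₁ × Fin d₂)) (_ : GaussTest.IsState ρ₀)
        (r₀ : ℝ) (_ : 0 ≤ r₀),
      GaussTest.stateP Sig T ρ₀ t r₀
          ≤ GaussTest.q m (t ^ 2) (GaussTest.dataRadius Sig T ρ₀ r₀ ^ 2) ∧
        ∀ (n : ℕ) (_ : 1 ≤ n) (g : Fin n → GaussTest.Herm (Fin d₁ × Fin d₂)),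
          GaussTest.IsTracelessONB g →
          GaussTest.dataRadius Sig T ρ₀ r₀ ^ 2
            = r₀ ^ 2 * GaussTest.lambdaMin
                ((GaussTest.restrictedMatrix T g)ᵀ * Sig⁻¹ * GaussTest.restrictedMatrix T g)) := by
  refine ⟨fun n hn S η μ r hr => ?_, fun d₁ d₂ T ρ₀ hρ r₀ hr => ⟨?_, fun n hn g hg => ?_⟩⟩
  · have h := GaussTest.isGreatest_nullProbs S hm hn hSig η μ ht hr
    have hp : GaussTest.p Sig S η μ t r = _ := h.csSup_eq
    exact ⟨hp, hp ▸ h.1⟩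
  · exact GaussTest.stateP_le hm hSig hρ hr ht
  · exact GaussTest.dataRadius_sq_eq hSig hρ.2 hr hn hg
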